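/- Let $\Bbbk$ be a field (of any characteristic), let $d\ge 1$, and let $R=\Bbbk[x_1,\dots,x_d]$ with its standard grading. Let $\mathcal D$ be the ring of $\Bbbk$-linear differential operators on $R$, i.e. $\mathcal D=R\langle \partial_i^{[t]} \mid 1\le i\le d,\ t\ge 1\rangle$ with $\partial_i^{[t]}=\frac1{t!}\frac{\partial^t}{\partial x_i^t}$, graded by $\deg x_i=1$ and $\deg\partial_i^{[t]}=-t$. A $\mathbb Z$-graded left $\mathcal D$-module $M=\bigoplus_{\ell\in\mathbb Z}M_\ell$ is called Eulerian if $$\Big(\sum_{t_1+\cdots+t_d=t;\ t_1,\dots,t_d\ge 0}x_1^{t_1}\cdots x_d^{t_d}\,\partial_1^{[t_1]}\cdots\partial_d^{[t_d]}\Big)z=\binom{\deg z}{t}z$$ for every homogeneous $z\in M$ and every integer $t\ge 1$. Let $M$ be a nonzero Eulerian graded $\mathcal D$-module (not assumed finitely generated), and let $\dim(\operatorname{Supp}_R M)$ be the supremum of lengths of chains of primes of $R$ in the support of $M$. 1. If $\dim(\operatorname{Supp}_R M)=0$, then (a) $M_\ell=0$ for every integer $\ell>-d$, and (b) $M_\ell\ne0$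 for every integer $\ell\le -d$. 2. If $\dim(\operatorname{Supp}_R M)>0$ and each element of $M$ is annihilated by a nonzero polynomial in $R$, then $M_\ell\neq 0$ for all $\ell\in\mathbb Z$. In particular, if each element of $M$ is annihilated by a nonzero polynomial in $R$, then $M_\ell\ne 0$ for every integer $\ell\le -d$. -/

import Mathlib

noncomputable section

namespace EulerianDMod

/-! ### Rings of differential operators -/

section General

variable {k A : Type*} [CommRing k] [CommRing A] [Algebra k A]

/-- `IsDiffOpLT n φ`: the `k`-linear endomorphism `φ` of `A` is a differential operator of
order `< n` in the sense of Grothendieck. Only `0` has order `< 0`, and `φ` has order `< n + 1`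
when all commutators `[φ, f]` with multiplications by elements `f` of `A` have order `< n`. -/
def IsDiffOpLT : ℕ → Module.End k A → Prop
  | 0, φ => φ = 0
  | n + 1, φ => ∀ f : A, IsDiffOpLT n (φ * LinearMap.mulLeft k f - LinearMap.mulLeft k f * φ)

theorem IsDiffOpLT.zero (n : ℕ) : IsDiffOpLT n (0 : Module.End k A) := by
  induction n with
  | zero => rfl
  | succ n ih => intro f; simpa using ih

theorem IsDiffOpLT.succ {n : ℕ} {φ : Module.End k A} (h : IsDiffOpLT n φ) :
    IsDiffOpLT (n + 1) φ := by
  induction n generalizing φ with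
  | zero => intro f; rw [show φ = 0 from h]; simpa using IsDiffOpLT.zero 0
  | succ n ih => intro f; exact ih (h f)

theorem IsDiffOpLT.mono {m n : ℕ} (hmn : m ≤ n) {φ : Module.End k A} (h : IsDiffOpLT m φ) :
    IsDiffOpLT n φ := by
  induction n, hmn using Nat.le_induction with
  | base => exact h
  | succ n _ ih => exact ih.succ

theorem IsDiffOpLT.add {n : ℕ} {φ ψ : Module.End k A} (hφ : IsDiffOpLT n φ)
    (hψ : IsDiffOpLT n ψ) : IsDiffOpLT n (φ + ψ) := by
  induction n generalizing φ ψ with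
  | zero => rw [show φ = 0 from hφ, show ψ = 0 from hψ]; exact add_zero 0
  | succ n ih =>
    intro f
    have := ih (hφ f) (hψ f)
    convert this using 1
    noncomm_ring

theorem IsDiffOpLT.mul {m n : ℕ} {φ ψ : Module.End k A} (hφ : IsDiffOpLT m φ)
    (hψ : IsDiffOpLT n ψ) : IsDiffOpLT (m + n) (φ * ψ) := by
  obtain ⟨s, hs⟩ : ∃ s, m + n = s := ⟨_, rfl⟩
  induction s generalizing m n φ ψ with
  | zero =>
    obtain rfl : m = 0 := by omega
    rw [show φ = 0 from hφ, zero_mul]; exact IsDiffOpLT.zero _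
  | succ s ih =>
    cases m with
    | zero => rw [show φ = 0 from hφ, zero_mul]; exact IsDiffOpLT.zero _
    | succ m =>
      cases n with
      | zero => rw [show ψ = 0 from hψ, mul_zero]; exact IsDiffOpLT.zero _
      | succ n =>
        rw [hs]
        intro f
        have h1 := ih hφ (hψ f) (by omega)
        have h2 := ih (hφ f) hψ (by omega)
        rw [show m + 1 + n = s by omega] at h1
        rw [show m + (n + 1) = s by omega] at h2
        convert h1.add h2 using 1
        simp only [mul_sub, sub_mul, mul_assoc]
        abel

theorem mulLeft_comm (f g : A) : LinearMap.mulLeft k f * LinearMap.mulLeft k g =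
    LinearMap.mulLeft k g * LinearMap.mulLeft k f := by
  ext x; simp [mul_left_comm]

theorem isDiffOpLT_mulLeft (f : A) : IsDiffOpLT 1 (LinearMap.mulLeft k f) := by
  intro g
  exact sub_eq_zero.mpr (mulLeft_comm f g)

theorem IsDiffOpLT.mulLeft_mul {n : ℕ} {φ : Module.End k A} (h : IsDiffOpLT n φ) (f : A) :
    IsDiffOpLT n (LinearMap.mulLeft k f * φ) := by
  induction n generalizing φ with
  | zero => rw [show φ = 0 from h]; exact mul_zero _
  | succ n ih =>
    intro g
    convert ih (h g) using 1
    rw [mul_sub, ← mul_assoc, ← mul_assoc, ← mul_assoc, mulLeft_comm g f]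

theorem IsDiffOpLT.mul_mulLeft {n : ℕ} {φ : Module.End k A} (h : IsDiffOpLT n φ) (f : A) :
    IsDiffOpLT n (φ * LinearMap.mulLeft k f) := by
  induction n generalizing φ with
  | zero => rw [show φ = 0 from h]; exact zero_mul _
  | succ n ih =>
    intro g
    convert ih (h g) using 1
    rw [sub_mul, mul_assoc, mul_assoc, mul_assoc, mulLeft_comm f g]

variable (k A)

/-- The ring of `k`-linear differential operators (of any finite order) on `A`, as a
subalgebra of the `k`-linear endomorphisms of `A`. -/
def diffOps : Subalgebra k (Module.End k A) where
  carrier := {φ | ∃ n, IsDiffOpLT n φ}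
  mul_mem' := by
    rintro φ ψ ⟨m, hm⟩ ⟨n, hn⟩
    exact ⟨m + n, hm.mul hn⟩
  add_mem' := by
    rintro φ ψ ⟨m, hm⟩ ⟨n, hn⟩
    exact ⟨max m n, (hm.mono (le_max_left _ _)).add (hn.mono (le_max_right _ _))⟩
  algebraMap_mem' c := by
    refine ⟨1, ?_⟩
    convert isDiffOpLT_mulLeft (k := k) (algebraMap k A c) using 1
    ext x
    simp [Algebra.smul_def]

/-- The inclusion `A → diffOps k A` sending `f` to multiplication by `f`. -/
def mulOp : A →+* diffOps k A where
  toFun f := ⟨LinearMap.mulLeft k f, 1, isDiffOpLT_mulLeft f⟩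
  map_one' := by ext x; simp
  map_mul' f g := by ext x; simp
  map_zero' := by ext x; simp
  map_add' f g := by ext x; simp [add_mul]

end General

/-! ### Differential operators on the polynomial ring -/

variable (k : Type*) [Field k] (d : ℕ)

/-- The ring `𝒟` of `k`-linear differential operators on `k[x₁, …, x_d]`. -/
abbrev DRing : Subalgebra k (Module.End k (MvPolynomial (Fin d) k)) :=
  diffOps k (MvPolynomial (Fin d) k)

variable {d}

/-- The divided power derivative `∂ᵢ^[t] = (1/t!) ∂^t/∂xᵢ^t` as an endomorphism of
`k[x₁, …, x_d]`: it sends `x^a` to `(aᵢ choose t) x^(a - t eᵢ)`. -/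
def dividedDerivEnd (i : Fin d) (t : ℕ) : Module.End k (MvPolynomial (Fin d) k) :=
  (MvPolynomial.basisMonomials (Fin d) k).constr k
    fun a => MvPolynomial.monomial (a - Finsupp.single i t) ((a i).choose t : k)

theorem dividedDerivEnd_monomial (i : Fin d) (t : ℕ) (a : Fin d →₀ ℕ) (c : k) :
    dividedDerivEnd k i t (MvPolynomial.monomial a c) =
      MvPolynomial.monomial (a - Finsupp.single i t) (c * ((a i).choose t : k)) := by
  have h : MvPolynomial.monomial a c =
      c • MvPolynomial.basisMonomials (Fin d) k a := by
    simp [MvPolynomial.smul_monomial]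
  rw [h, map_smul, dividedDerivEnd, Module.Basis.constr_basis, MvPolynomial.smul_monomial,
    smul_eq_mul]

theorem end_ext {φ ψ : Module.End k (MvPolynomial (Fin d) k)}
    (h : ∀ a c, φ (MvPolynomial.monomial a c) = ψ (MvPolynomial.monomial a c)) : φ = ψ :=
  (MvPolynomial.basisMonomials (Fin d) k).ext fun a => by simpa using h a 1

theorem dividedDerivEnd_comm_X (i j : Fin d) (t : ℕ) :
    dividedDerivEnd k i (t + 1) * LinearMap.mulLeft k (MvPolynomial.X j) -
      LinearMap.mulLeft k (MvPolynomial.X j) * dividedDerivEnd k i (t + 1) =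
      if i = j then dividedDerivEnd k i t else 0 := by
  rw [sub_eq_iff_eq_add]
  refine end_ext k fun a c => ?_
  have hX : ∀ (b : Fin d →₀ ℕ) (e : k), MvPolynomial.X j * MvPolynomial.monomial b e =
      MvPolynomial.monomial (Finsupp.single j 1 + b) e := by
    intro b e; rw [MvPolynomial.X, MvPolynomial.monomial_mul, one_mul]
  split_ifs with hij
  · subst hij
    simp only [Module.End.mul_apply, LinearMap.mulLeft_apply,
      LinearMap.add_apply, hX, dividedDerivEnd_monomial]
    have e1 : Finsupp.single i 1 + a - Finsupp.single i (t + 1) = a - Finsupp.single i t := by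
      ext l; by_cases h : i = l
      · subst h; simp; omega
      · simp [Finsupp.single_eq_of_ne' h]
    rw [e1]
    have e2 : ((Finsupp.single i 1 + a : Fin d →₀ ℕ) i).choose (t + 1) =
        (a i).choose t + (a i).choose (t + 1) := by
      rw [Finsupp.add_apply, Finsupp.single_eq_same, add_comm 1, Nat.choose_succ_succ]
    rw [e2, Nat.cast_add, mul_add, map_add]
    congr 1
    by_cases h : t + 1 ≤ a i
    · congr 2
      ext l; by_cases h' : i = l
      · subst h'; simp; omega
      · simp [Finsupp.single_eq_of_ne' h']
    · rw [Nat.choose_eq_zero_of_lt (by omega)]; simp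
  · simp only [Module.End.mul_apply, LinearMap.mulLeft_apply, hX, dividedDerivEnd_monomial, zero_add]
    have e1 : Finsupp.single j 1 + a - Finsupp.single i (t + 1) =
        Finsupp.single j 1 + (a - Finsupp.single i (t + 1)) := by
      ext l; by_cases h : i = l
      · subst h; simp [Finsupp.single_eq_of_ne hij]
      · simp [Finsupp.single_eq_of_ne' h]
    rw [e1]
    simp [Finsupp.single_eq_of_ne hij]

theorem isDiffOpLT_dividedDerivEnd (i : Fin d) (t : ℕ) :
    IsDiffOpLT (t + 1) (dividedDerivEnd k i t) := by
  induction t with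
  | zero =>
    convert isDiffOpLT_mulLeft (k := k) (1 : MvPolynomial (Fin d) k) using 1
    refine end_ext k fun a c => ?_
    simp [dividedDerivEnd_monomial]
  | succ t ih =>
    intro f
    induction f using MvPolynomial.induction_on with
    | C c =>
      convert IsDiffOpLT.zero (k := k) (A := MvPolynomial (Fin d) k) (t + 1) using 1
      refine LinearMap.ext fun x => ?_
      simp [← MvPolynomial.smul_eq_C_mul]
    | add p q hp hq =>
      convert hp.add hq using 1
      rw [show LinearMap.mulLeft k (p + q) = LinearMap.mulLeft k p + LinearMap.mulLeft k q by
        refine LinearMap.ext fun x => ?_; simp [add_mul]]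
      noncomm_ring
    | mul_X p j hp =>
      have hX : IsDiffOpLT (t + 1)
          (dividedDerivEnd k i (t + 1) * LinearMap.mulLeft k (MvPolynomial.X j) -
            LinearMap.mulLeft k (MvPolynomial.X j) * dividedDerivEnd k i (t + 1)) := by
        rw [dividedDerivEnd_comm_X]
        split_ifs
        · exact ih
        · exact IsDiffOpLT.zero _
      convert (hp.mul_mulLeft (MvPolynomial.X j)).add (hX.mulLeft_mul p) using 1
      rw [show LinearMap.mulLeft k (p * MvPolynomial.X j) =
        LinearMap.mulLeft k p * LinearMap.mulLeft k (MvPolynomial.X j) by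
        refine LinearMap.ext fun x => ?_; simp]
      simp only [mul_sub, sub_mul, mul_assoc]
      abel

/-- The divided power derivative `∂ᵢ^[t]` as an element of `𝒟`. -/
def dividedDeriv (i : Fin d) (t : ℕ) : DRing k d :=
  ⟨dividedDerivEnd k i t, t + 1, isDiffOpLT_dividedDerivEnd k i t⟩

/-- `φ ∈ 𝒟` is homogeneous of degree `n ∈ ℤ`: it raises the degree of every homogeneous
polynomial by `n`. This is the natural grading of `𝒟`, with `deg xᵢ = 1` and
`deg ∂ᵢ^[t] = -t`. -/
def HasDegree (n : ℤ) (φ : DRing k d) : Prop :=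
  ∀ (m : ℕ) (f : MvPolynomial (Fin d) k), f.IsHomogeneous m →
    ∀ b ∈ ((φ : Module.End k (MvPolynomial (Fin d) k)) f).support, (b.degree : ℤ) = m + n

theorem hasDegree_X (i : Fin d) :
    HasDegree k 1 (mulOp k (MvPolynomial (Fin d) k) (MvPolynomial.X i)) := by
  intro m f hf b hb
  have h := ((MvPolynomial.isHomogeneous_X k i).mul hf) (MvPolynomial.mem_support_iff.mp hb)
  rw [show Finsupp.weight (1 : Fin d → ℕ) = Finsupp.degree from
    Finsupp.degree_eq_weight_one.symm] at h
  change b.degree = 1 + m at h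
  omega

theorem hasDegree_dividedDeriv (i : Fin d) (t : ℕ) :
    HasDegree k (-(t : ℤ)) (dividedDeriv k i t) := by
  intro m f hf b hb
  change b ∈ (dividedDerivEnd k i t f).support at hb
  rw [f.as_sum, map_sum] at hb
  obtain ⟨a, ha, hab⟩ := Finset.mem_biUnion.mp (MvPolynomial.support_sum hb)
  rw [dividedDerivEnd_monomial] at hab
  have hne : MvPolynomial.coeff a f * ((a i).choose t : k) ≠ 0 := by
    rintro h0; simp [h0] at hab
  have hle : t ≤ a i := by
    by_contra h
    exact hne (by rw [Nat.choose_eq_zero_of_lt (by omega)]; simp)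
  have hb' : b = a - Finsupp.single i t := by
    simpa using MvPolynomial.support_monomial_subset hab
  have hadd : b + Finsupp.single i t = a := by
    rw [hb']; exact tsub_add_cancel_of_le (Finsupp.single_le_iff.mpr hle)
  have h := hf (MvPolynomial.mem_support_iff.mp ha)
  rw [show Finsupp.weight (1 : Fin d → ℕ) = Finsupp.degree from
    Finsupp.degree_eq_weight_one.symm] at h
  change a.degree = m at h
  rw [← hadd, map_add, Finsupp.degree_single] at h
  omega

/-- The `t`-th Euler operator
`∑_{t₁ + ⋯ + t_d = t} x₁^{t₁} ⋯ x_d^{t_d} ∂₁^[t₁] ⋯ ∂_d^[t_d]` in `𝒟`. -/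
def eulerOp (d t : ℕ) : DRing k d :=
  ∑ s ∈ Finset.piAntidiag (Finset.univ : Finset (Fin d)) t,
    mulOp k (MvPolynomial (Fin d) k) (∏ i, MvPolynomial.X i ^ s i) *
      (List.ofFn fun i => dividedDeriv k i (s i)).prod

/-! ### Eulerian graded `𝒟`-modules -/

variable (d) {M : Type*} [AddCommGroup M] [Module (DRing k d) M]

/-- `ℳ` makes the left `𝒟`-module `M` a `ℤ`-graded `𝒟`-module. -/
structure IsGradedDModule (ℳ : ℤ → AddSubgroup M) : Prop where
  isInternal : DirectSum.IsInternal ℳ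
  smul_mem : ∀ (n ℓ : ℤ) (φ : DRing k d) (z : M), HasDegree k n φ → z ∈ ℳ ℓ → φ • z ∈ ℳ (n + ℓ)

/-- `ℳ` makes `M` an Eulerian graded `𝒟`-module: for all `t ≥ 1` the `t`-th Euler operator acts
on each homogeneous element `z` as the integer `(deg z choose t)`. -/
structure IsEulerianGraded (ℳ : ℤ → AddSubgroup M) : Prop extends IsGradedDModule k d ℳ where
  euler_smul : ∀ (t : ℕ), 1 ≤ t → ∀ (ℓ : ℤ) (z : M), z ∈ ℳ ℓ →
    eulerOp k d t • z = Ring.choose ℓ t • z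

variable (M)

/-- The dimension of `Supp_R(M) ⊆ Spec R`, where `R = k[x₁, …, x_d]` acts on the `𝒟`-module `M`
through `R ⊆ 𝒟`. -/
def suppDim : WithBot ℕ∞ :=
  letI : Module (MvPolynomial (Fin d) k) M :=
    Module.compHom M (mulOp k (MvPolynomial (Fin d) k))
  Module.supportDim (MvPolynomial (Fin d) k) M

/-- Each element of `M` is annihilated by a nonzero polynomial. -/
def IsPolyTorsion : Prop :=
  ∀ z : M, ∃ f : MvPolynomial (Fin d) k, f ≠ 0 ∧ mulOp k (MvPolynomial (Fin d) k) f • z = 0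

end EulerianDMod

end

/-!
Write `𝔪 = (x₁, …, x_d)` and call a vector torsion if a power of `𝔪` kills it. The Euler operators
enter through two consequences, valid in every characteristic.

* If `ℳ a = 0` and `a ≤ ℓ`, then every term `x^s ∂^[s]` of the `t`-th Euler operator with
  `t ≥ ℓ - a` passes through degree `a` on its way, so `(ℓ choose t)` kills `ℳ ℓ` for all large `t`.
  As `(1 + X)^ℓ` is not a polynomial for `ℓ < 0`, and `(ℓ choose ℓ) = 1` for `ℓ ≥ 0`, a nonzero
  `ℳ ℓ` forces `ℳ a ≠ 0` for `a ≤ ℓ`, except when `a < 0 ≤ ℓ`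
  (`IsEulerianGraded.ne_bot_of_le`).
* On a vector killed by all `xᵢ`, moving the `xᵢ` to the right of the derivatives shows that the
  Euler operators act as `(-d choose t)`. Since the powers of `1 + X` in `k⟦X⟧` are distinct,
  such a homogeneous vector has degree `-d` (`IsEulerianGraded.eq_neg_of_X_smul_eq_zero`).

If the support has dimension `0`, all homogeneous vectors are torsion. A nonzero one can be
multiplied by variables until it is killed by all of them, so its degree is at most `-d`, and
`ℳ (-d) ≠ 0`; the first consequence supplies the degrees below `-d`.

If the support has positive dimension, some homogeneous vector is not torsion. Multiplying by
variables gives such vectors in arbitrarily high degrees, so only the step from degree `0` to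
degree `-1` is missing (`IsGradedDModule.neg_one_ne_bot`). If `ℳ (-1) = 0`, then all vectors of
negative degree are torsion. Let `z` be a homogeneous vector that is not torsion, of minimal
degree; all its derivatives `∂ᵢ^[v] z`, `v ≥ 1`, are torsion. By the Leibniz rule, the set of
polynomials `f` for which `f z` is torsion is then stable under all `∂ᵢ^[t]`. If it contains a
nonzero polynomial, it contains a nonzero constant, and `z` is torsion, a contradiction.
-/

namespace EulerianDMod

open MvPolynomial

/-! ### Binomial coefficients with integer upper entry in a field -/

section Binomial

variable (k : Type*) [Field k]

theorem coeff_binomialSeries_int (ℓ : ℤ) (t : ℕ) :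
    PowerSeries.coeff t (PowerSeries.binomialSeries k ℓ) = ((Ring.choose ℓ t : ℤ) : k) := by
  simp

/-- The coefficients of `(1 + X)^ℓ` over `k` determine `ℓ`, in any characteristic: if
`(1 + X)^ℓ = (1 + X)^(ℓ + m)` with `m ≥ 0`, then `(1 + X)^m = 1`, so `m = 0` by degrees. -/
theorem eq_of_forall_choose_cast_eq {ℓ ℓ' : ℤ}
    (h : ∀ t : ℕ, ((Ring.choose ℓ t : ℤ) : k) = ((Ring.choose ℓ' t : ℤ) : k)) : ℓ = ℓ' := by
  wlog hle : ℓ ≤ ℓ' generalizing ℓ ℓ'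
  · exact (this (fun t => (h t).symm) (by omega)).symm
  obtain ⟨m, rfl⟩ := Int.le.dest hle
  have hs : PowerSeries.binomialSeries k ℓ = PowerSeries.binomialSeries k (ℓ + m) := by
    ext t
    simpa only [coeff_binomialSeries_int] using h t
  have hne : PowerSeries.binomialSeries k ℓ ≠ 0 := by
    intro h0
    have := congrArg PowerSeries.constantCoeff h0
    simp at this
  have h1 : (1 + PowerSeries.X : PowerSeries k) ^ m = 1 := by
    rw [PowerSeries.binomialSeries_add, PowerSeries.binomialSeries_nat] at hs
    exact mul_left_cancel₀ hne (by rw [← hs, mul_one])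
  have h2 : (1 + Polynomial.X : Polynomial k) ^ m = 1 := by
    apply Polynomial.coe_injective k
    simpa using h1
  have h3 := congrArg Polynomial.natDegree h2
  rw [add_comm, ← Polynomial.C_1, Polynomial.natDegree_pow, Polynomial.natDegree_X_add_C] at h3
  simp at h3
  simp [h3]

/-- The power series `(1 + X)^ℓ` with `ℓ < 0` is not a polynomial, over any field. -/
theorem exists_choose_cast_ne_zero_of_neg {ℓ : ℤ} (hℓ : ℓ < 0) (n : ℕ) :
    ∃ t, n ≤ t ∧ ((Ring.choose ℓ t : ℤ) : k) ≠ 0 := by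
  by_contra! h
  obtain ⟨m, hm⟩ : ∃ m : ℕ, ℓ + m = 0 := ⟨ℓ.natAbs, by omega⟩
  set g : Polynomial k := PowerSeries.trunc n (PowerSeries.binomialSeries k ℓ)
  have hg : (g : PowerSeries k) = PowerSeries.binomialSeries k ℓ := by
    ext t
    rw [Polynomial.coeff_coe, PowerSeries.coeff_trunc, coeff_binomialSeries_int]
    split_ifs with ht
    · rfl
    · exact (h t (by omega)).symm
  have h1 : (g : PowerSeries k) * (1 + PowerSeries.X) ^ m = 1 := by
    rw [hg, ← PowerSeries.binomialSeries_nat (R := ℤ), ← PowerSeries.binomialSeries_add, hm,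
      PowerSeries.binomialSeries_zero]
  have h2 : g * (1 + Polynomial.X) ^ m = 1 := by
    apply Polynomial.coe_injective k
    simpa using h1
  have h3 : IsUnit ((1 + Polynomial.X : Polynomial k) ^ m) := IsUnit.of_mul_eq_one_right g h2
  have h4 := Polynomial.natDegree_eq_zero_of_isUnit h3
  rw [add_comm, ← Polynomial.C_1, Polynomial.natDegree_pow, Polynomial.natDegree_X_add_C] at h4
  omega

end Binomial

/-! ### Degrees and commutation in the ring of differential operators -/

section Operators

variable {k : Type*} [Field k] {d : ℕ}

local notation "mulR" => mulOp k (MvPolynomial (Fin d) k)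

theorem HasDegree.mul {m n : ℤ} {φ ψ : DRing k d} (hφ : HasDegree k m φ) (hψ : HasDegree k n ψ) :
    HasDegree k (m + n) (φ * ψ) := by
  intro a f hf b hb
  have h1 := hψ a f hf
  set g := (ψ : Module.End k (MvPolynomial (Fin d) k)) f with hg
  change b ∈ ((φ : Module.End k (MvPolynomial (Fin d) k)) g).support at hb
  have hg0 : g ≠ 0 := by rintro h0; simp [h0] at hb
  obtain ⟨c, hc⟩ := MvPolynomial.support_nonempty.mpr hg0
  obtain ⟨e, he⟩ : ∃ e : ℕ, (e : ℤ) = a + n := ⟨c.degree, h1 c hc⟩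
  have hgh : g.IsHomogeneous e := by
    intro x hx
    have := h1 x (MvPolynomial.mem_support_iff.mpr hx)
    rw [show Finsupp.weight (1 : Fin d → ℕ) = Finsupp.degree from
      Finsupp.degree_eq_weight_one.symm]
    change x.degree = e
    omega
  have := hφ e g hgh b hb
  omega

theorem hasDegree_mulOp {m : ℕ} {f : MvPolynomial (Fin d) k} (hf : f.IsHomogeneous m) :
    HasDegree k m (mulR f) := by
  intro a g hg b hb
  have h := (hf.mul hg) (MvPolynomial.mem_support_iff.mp hb)
  rw [show Finsupp.weight (1 : Fin d → ℕ) = Finsupp.degree from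
    Finsupp.degree_eq_weight_one.symm] at h
  change b.degree = m + a at h
  omega

theorem hasDegree_one : HasDegree k 0 (1 : DRing k d) := by
  simpa using hasDegree_mulOp (k := k) (MvPolynomial.isHomogeneous_one (Fin d) k)

theorem hasDegree_list_prod_dividedDeriv (s : Fin d → ℕ) (l : List (Fin d)) :
    HasDegree k (-((l.map s).sum : ℤ)) (l.map fun i => dividedDeriv k i (s i)).prod := by
  induction l with
  | nil => simpa using hasDegree_one
  | cons i l ih =>
    have := (hasDegree_dividedDeriv k i (s i)).mul ih
    simpa [add_comm] using this

theorem dividedDerivEnd_zero (i : Fin d) : dividedDerivEnd k i 0 = 1 :=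
  end_ext k fun a c => by simp [dividedDerivEnd_monomial]

theorem dividedDeriv_zero (i : Fin d) : dividedDeriv k i 0 = 1 :=
  Subtype.ext (dividedDerivEnd_zero i)

theorem dividedDerivEnd_succ_C (i : Fin d) (t : ℕ) (c : k) :
    dividedDerivEnd k i (t + 1) (C c) = 0 := by
  rw [C_apply, dividedDerivEnd_monomial]
  simp

theorem commute_dividedDeriv_C (i : Fin d) (t : ℕ) (c : k) :
    Commute (dividedDeriv k i t) (mulR (C c)) := by
  have h : dividedDerivEnd k i t * LinearMap.mulLeft k (C c) =
      LinearMap.mulLeft k (C c) * dividedDerivEnd k i t := by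
    refine LinearMap.ext fun x => ?_
    simp only [Module.End.mul_apply, LinearMap.mulLeft_apply, ← smul_eq_C_mul, map_smul]
  exact Subtype.ext h

theorem dividedDeriv_succ_mul_X (i j : Fin d) (t : ℕ) :
    dividedDeriv k i (t + 1) * mulR (X j) =
      mulR (X j) * dividedDeriv k i (t + 1) + if i = j then dividedDeriv k i t else 0 := by
  have h := dividedDerivEnd_comm_X k i j t
  rw [sub_eq_iff_eq_add'] at h
  apply Subtype.ext
  refine h.trans ?_
  split_ifs <;> rfl

theorem commute_dividedDeriv_X {i j : Fin d} (hij : i ≠ j) (t : ℕ) :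
    Commute (dividedDeriv k i t) (mulR (X j)) := by
  cases t with
  | zero => rw [dividedDeriv_zero]; exact Commute.one_left _
  | succ t => exact (dividedDeriv_succ_mul_X (k := k) i j t).trans (by rw [if_neg hij, add_zero])

theorem coeff_dividedDerivEnd (i : Fin d) (t : ℕ) (f : MvPolynomial (Fin d) k)
    (c : Fin d →₀ ℕ) :
    coeff c (dividedDerivEnd k i t f) =
      coeff (c + Finsupp.single i t) f * ((c i + t).choose t : k) := by
  induction f using MvPolynomial.induction_on' with
  | monomial a r =>
    rw [dividedDerivEnd_monomial, coeff_monomial, coeff_monomial]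
    by_cases hta : t ≤ a i
    · have hle : Finsupp.single i t ≤ a := Finsupp.single_le_iff.mpr hta
      by_cases h : a - Finsupp.single i t = c
      · have h' : a = c + Finsupp.single i t := by
          rw [← h, tsub_add_cancel_of_le hle]
        rw [if_pos h, if_pos h', h']
        simp
      · rw [if_neg h, if_neg, zero_mul]
        rintro rfl
        simp at h
    · rw [Nat.choose_eq_zero_of_lt (by omega), if_neg (c := a = _)]
      · simp
      · rintro rfl
        simp at hta
  | add p q hp hq => rw [map_add, coeff_add, coeff_add, hp, hq, add_mul]

/-- A nonconstant polynomial has a divided power derivative that is nonzero and of smaller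
total degree: differentiate with respect to `xᵢ` as often as `xᵢ` occurs in some monomial. -/
theorem exists_dividedDerivEnd_ne_zero {f : MvPolynomial (Fin d) k} (hf : f.totalDegree ≠ 0) :
    ∃ i t, dividedDerivEnd k i t f ≠ 0 ∧
      (dividedDerivEnd k i t f).totalDegree < f.totalDegree := by
  obtain ⟨b, hb, hb0⟩ : ∃ b ∈ f.support, b ≠ 0 := by
    by_contra! h
    refine hf (Nat.le_zero.mp (Finset.sup_le fun b hb => ?_))
    simp [h b hb]
  obtain ⟨i, hi⟩ : ∃ i, b i ≠ 0 := by
    by_contra! h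
    exact hb0 (Finsupp.ext h)
  refine ⟨i, b i, fun h0 => ?_, ?_⟩
  · have h := coeff_dividedDerivEnd i (b i) f (b.erase i)
    rw [h0, Finsupp.erase_add_single, Finsupp.erase_same] at h
    simp only [coeff_zero, zero_add, Nat.choose_self, Nat.cast_one, mul_one] at h
    exact MvPolynomial.mem_support_iff.mp hb h.symm
  · refine (Finset.sup_lt_iff (by simpa using Nat.pos_of_ne_zero hf)).mpr fun c hc => ?_
    rw [MvPolynomial.mem_support_iff, coeff_dividedDerivEnd] at hc
    have h := MvPolynomial.le_totalDegree
      (MvPolynomial.mem_support_iff.mpr (left_ne_zero_of_mul hc))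
    change (c + Finsupp.single i (b i)).degree ≤ _ at h
    rw [map_add, Finsupp.degree_single] at h
    change c.degree < _
    omega

/-- On a vector killed by `xᵢ`, the operator `xᵢ^t ∂ᵢ^[t]` is `(-1)^t`, because
`xᵢ ∂ᵢ^[t+1] = ∂ᵢ^[t+1] xᵢ - ∂ᵢ^[t]`. -/
theorem X_pow_mul_dividedDeriv_smul {M : Type*} [AddCommGroup M] [Module (DRing k d) M] {z : M}
    {i : Fin d} (hz : mulR (X i) • z = 0) (t : ℕ) :
    (mulR (X i ^ t) * dividedDeriv k i t) • z = (-1 : ℤ) ^ t • z := by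
  induction t with
  | zero => simp [dividedDeriv_zero]
  | succ t ih =>
    have h := congrArg (· • z) (dividedDeriv_succ_mul_X (k := k) i i t)
    simp only [if_true, mul_smul, add_smul, hz, smul_zero] at h
    rw [pow_succ, map_mul, mul_smul, mul_smul, eq_neg_of_add_eq_zero_left h.symm, smul_neg,
      ← mul_smul, ih, pow_succ, mul_neg_one, neg_smul]

theorem list_prod_X_pow_mul_dividedDeriv_smul {M : Type*} [AddCommGroup M]
    [Module (DRing k d) M] {z : M} (hz : ∀ i, mulR (X i) • z = 0) (s : Fin d → ℕ)
    {l : List (Fin d)} (hl : l.Nodup) :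
    (mulR (l.map fun i => X i ^ s i).prod * (l.map fun i => dividedDeriv k i (s i)).prod) • z =
      (-1 : ℤ) ^ (l.map s).sum • z := by
  induction l with
  | nil => simp
  | cons i l ih =>
    rw [List.nodup_cons] at hl
    have hcomm : Commute (dividedDeriv k i (s i)) (mulR (l.map fun i => X i ^ s i).prod) := by
      rw [map_list_prod]
      refine Commute.list_prod_right _ _ fun y hy => ?_
      simp only [List.map_map, List.mem_map, Function.comp_apply] at hy
      obtain ⟨j, hj, rfl⟩ := hy
      rw [map_pow]
      exact (commute_dividedDeriv_X (by rintro rfl; exact hl.1 hj) _).pow_right _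
    simp only [List.map_cons, List.prod_cons, List.sum_cons, map_mul]
    rw [mul_assoc, ← mul_assoc _ (dividedDeriv k i (s i)), ← hcomm.eq, mul_assoc, ← mul_assoc,
      mul_smul, ih hl.2, smul_comm, X_pow_mul_dividedDeriv_smul (hz i), ← mul_smul, pow_add,
      mul_comm]

theorem eulerOp_summand_eq (s : Fin d → ℕ) :
    mulR (∏ i, X i ^ s i) * (List.ofFn fun i => dividedDeriv k i (s i)).prod =
      mulR ((List.finRange d).map fun i => X i ^ s i).prod *
        ((List.finRange d).map fun i => dividedDeriv k i (s i)).prod := by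
  rw [List.ofFn_eq_map, ← List.ofFn_eq_map (f := fun i => (X i : MvPolynomial (Fin d) k) ^ s i),
    List.prod_ofFn]

theorem card_piAntidiag_univ_fin (d t : ℕ) :
    (Finset.piAntidiag (Finset.univ : Finset (Fin d)) t).card = d.multichoose t := by
  rw [← Finset.map_sym_eq_piAntidiag, Finset.card_map, Finset.sym_univ, Finset.card_univ,
    Sym.card_sym_eq_multichoose, Fintype.card_fin]

theorem choose_neg_natCast_int (d t : ℕ) :
    Ring.choose (-(d : ℤ)) t = (-1) ^ t * (d.multichoose t : ℤ) := by
  rw [Ring.choose_neg', Nat.multichoose_eq, Units.smul_def, Int.coe_negOnePow_natCast, smul_eq_mul]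
  rfl

/-- On a vector killed by all `xᵢ`, the Euler operators act as on the generator, of degree `-d`,
of the top local cohomology of the polynomial ring. -/
theorem eulerOp_smul_of_X_smul_eq_zero {M : Type*} [AddCommGroup M] [Module (DRing k d) M] {z : M}
    (hz : ∀ i, mulR (X i) • z = 0) (t : ℕ) :
    eulerOp k d t • z = Ring.choose (-(d : ℤ)) t • z := by
  have h : ∀ s ∈ Finset.piAntidiag (Finset.univ : Finset (Fin d)) t,
      (mulR (∏ i, X i ^ s i) * (List.ofFn fun i => dividedDeriv k i (s i)).prod) • z =
        (-1 : ℤ) ^ t • z := by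
    intro s hs
    rw [eulerOp_summand_eq, list_prod_X_pow_mul_dividedDeriv_smul hz s (List.nodup_finRange d),
      ← List.ofFn_eq_map, List.sum_ofFn, (Finset.mem_piAntidiag.mp hs).1]
  rw [eulerOp, Finset.sum_smul, Finset.sum_congr rfl h, Finset.sum_const,
    card_piAntidiag_univ_fin, choose_neg_natCast_int, mul_comm, mul_smul, Nat.cast_smul_eq_nsmul]

end Operators

/-! ### Vectors killed by a power of the irrelevant ideal -/

section Torsion

variable {k : Type*} [Field k] {d : ℕ} {M : Type*} [AddCommGroup M] [Module (DRing k d) M]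

local notation "mulR" => mulOp k (MvPolynomial (Fin d) k)

variable (k d) in
/-- `IsVarTorsion k d z`: the vector `z` of the `𝒟`-module `M` is killed by all monomials in
`x₁, …, x_d` of sufficiently large degree, in other words `z` lies in `H⁰_𝔪(M)` for
`𝔪 = (x₁, …, x_d)`. It is encoded inductively: `0` is torsion, and `z` is torsion as soon as all
`xᵢ z` are. -/
inductive IsVarTorsion : M → Prop
  | zero : IsVarTorsion 0
  | of_smul (z : M) (h : ∀ i, IsVarTorsion (mulR (X i) • z)) : IsVarTorsion z

theorem IsVarTorsion.mulOp_smul {z : M} (hz : IsVarTorsion k d z) (f : MvPolynomial (Fin d) k) :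
    IsVarTorsion k d (mulR f • z) := by
  induction hz with
  | zero => rw [smul_zero]; exact .zero
  | of_smul z _ ih =>
    refine .of_smul _ fun i => ?_
    rw [← mul_smul, ← map_mul, mul_comm, map_mul, mul_smul]
    exact ih i

theorem IsVarTorsion.add {z w : M} (hz : IsVarTorsion k d z) (hw : IsVarTorsion k d w) :
    IsVarTorsion k d (z + w) := by
  induction hz generalizing w with
  | zero => rwa [zero_add]
  | of_smul z _ ih =>
    refine .of_smul _ fun i => ?_
    rw [smul_add]
    exact ih i (hw.mulOp_smul _)

theorem IsVarTorsion.neg {z : M} (hz : IsVarTorsion k d z) : IsVarTorsion k d (-z) := by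
  simpa using hz.mulOp_smul (-1)

theorem IsVarTorsion.sub {z w : M} (hz : IsVarTorsion k d z) (hw : IsVarTorsion k d w) :
    IsVarTorsion k d (z - w) := by
  rw [sub_eq_add_neg]; exact hz.add hw.neg

theorem X_smul_dividedDeriv_succ_smul (i j : Fin d) (t : ℕ) (z : M) :
    mulR (X j) • dividedDeriv k i (t + 1) • z =
      dividedDeriv k i (t + 1) • mulR (X j) • z - if i = j then dividedDeriv k i t • z else 0 := by
  have h := congrArg (· • z) (dividedDeriv_succ_mul_X (k := k) i j t)
  simp only [mul_smul, add_smul] at h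
  rw [h]
  split_ifs <;> simp

theorem IsVarTorsion.dividedDeriv_smul {z : M} (hz : IsVarTorsion k d z) (i : Fin d) (t : ℕ) :
    IsVarTorsion k d (dividedDeriv k i t • z) := by
  induction hz generalizing t with
  | zero => rw [smul_zero]; exact .zero
  | of_smul z hz ih =>
    induction t with
    | zero => rw [dividedDeriv_zero, one_smul]; exact .of_smul z hz
    | succ t iht =>
      refine .of_smul _ fun j => ?_
      rw [X_smul_dividedDeriv_succ_smul]
      refine (ih j (t + 1)).sub ?_
      split_ifs
      · exact iht
      · exact .zero

theorem isVarTorsion_of_pow_smul_eq_zero {N : ℕ} {z : M}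
    (h : ∀ f ∈ idealOfVars (Fin d) k ^ N, mulR f • z = 0) : IsVarTorsion k d z := by
  induction N generalizing z with
  | zero =>
    have := h 1 (by simp)
    rw [map_one, one_smul] at this
    rw [this]; exact .zero
  | succ N ih =>
    refine .of_smul _ fun i => ih fun f hf => ?_
    rw [← mul_smul, ← map_mul]
    exact h _ (pow_succ (idealOfVars (Fin d) k) N ▸
      Ideal.mul_mem_mul hf (Ideal.subset_span ⟨i, rfl⟩))

/-- A prime that contains the annihilator of a torsion vector contains all variables. -/
theorem IsVarTorsion.X_mem {z : M} (hz : IsVarTorsion k d z) {P : Ideal (MvPolynomial (Fin d) k)}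
    [hP : P.IsPrime] (h : ∀ f, mulR f • z = 0 → f ∈ P) (i : Fin d) : X i ∈ P := by
  induction hz with
  | zero => exact absurd (h 1 (smul_zero _)) ((Ideal.ne_top_iff_one P).mp hP.ne_top)
  | of_smul z _ ih =>
    by_contra hi
    refine hi (ih i fun f hf => ?_)
    rw [← mul_smul, ← map_mul] at hf
    exact (hP.mem_or_mem (h _ hf)).resolve_right hi

/-- Leibniz rule modulo torsion: if all `∂ᵢ^[v] z` with `v ≥ 1` are torsion, then
`∂ᵢ^[t] (f z)` and `(∂ᵢ^[t] f) z` agree up to torsion. -/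
theorem isVarTorsion_dividedDeriv_mulOp_smul_sub {z : M} {i : Fin d}
    (hz : ∀ v, IsVarTorsion k d (dividedDeriv k i (v + 1) • z)) (f : MvPolynomial (Fin d) k)
    (t : ℕ) : IsVarTorsion k d
      (dividedDeriv k i t • mulR f • z - mulR (dividedDerivEnd k i t f) • z) := by
  induction f using MvPolynomial.induction_on generalizing t with
  | C c =>
    rw [← mul_smul, (commute_dividedDeriv_C i t c).eq, mul_smul]
    cases t with
    | zero =>
      rw [dividedDerivEnd_zero, Module.End.one_apply, dividedDeriv_zero, one_smul, sub_self]
      exact .zero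
    | succ t =>
      rw [dividedDerivEnd_succ_C, map_zero, zero_smul, sub_zero]
      exact (hz t).mulOp_smul _
  | add p q hp hq =>
    have := (hp t).add (hq t)
    rw [map_add, map_add, map_add, add_smul, add_smul, smul_add]
    rwa [add_sub_add_comm]
  | mul_X p j hp =>
    cases t with
    | zero =>
      rw [dividedDeriv_zero, dividedDerivEnd_zero, Module.End.one_apply, one_smul, sub_self]
      exact .zero
    | succ t =>
      have h1 : dividedDerivEnd k i (t + 1) (p * X j) = X j * dividedDerivEnd k i (t + 1) p +
          if i = j then dividedDerivEnd k i t p else 0 := by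
        have h := congrArg (· p) (dividedDerivEnd_comm_X k i j t)
        simp only [LinearMap.sub_apply, Module.End.mul_apply, LinearMap.mulLeft_apply] at h
        rw [mul_comm p, ← sub_eq_iff_eq_add', h]
        split_ifs <;> rfl
      have h2 : dividedDeriv k i (t + 1) • mulR (p * X j) • z =
          mulR (X j) • dividedDeriv k i (t + 1) • mulR p • z +
            if i = j then dividedDeriv k i t • mulR p • z else 0 := by
        rw [X_smul_dividedDeriv_succ_smul, mul_comm p, map_mul, mul_smul, sub_add_cancel]
      rw [h1, h2, map_add, add_smul, map_mul, mul_smul, add_sub_add_comm, ← smul_sub]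
      refine ((hp (t + 1)).mulOp_smul _).add ?_
      split_ifs
      · exact hp t
      · simpa using IsVarTorsion.zero

/-- If all `∂ᵢ^[v] z` with `v ≥ 1` are torsion and some `f ≠ 0` kills `z` up to torsion, then
differentiating `f` down to a nonzero constant shows that `z` is torsion. -/
theorem isVarTorsion_of_dividedDeriv {z : M}
    (hz : ∀ (i : Fin d) v, IsVarTorsion k d (dividedDeriv k i (v + 1) • z))
    {f : MvPolynomial (Fin d) k} (hf : f ≠ 0) (hfz : IsVarTorsion k d (mulR f • z)) :
    IsVarTorsion k d z := by
  obtain ⟨n, hn⟩ : ∃ n, f.totalDegree = n := ⟨_, rfl⟩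
  induction n using Nat.strong_induction_on generalizing f with
  | _ n ih =>
    by_cases h0 : f.totalDegree = 0
    · rw [totalDegree_eq_zero_iff_eq_C] at h0
      have hc : coeff 0 f ≠ 0 := by
        rintro hc; rw [hc, C_0] at h0; exact hf h0
      have h := hfz.mulOp_smul (C (coeff 0 f)⁻¹)
      rwa [h0, coeff_C, if_pos rfl, ← mul_smul, ← map_mul, ← C_mul, inv_mul_cancel₀ hc, C_1,
        map_one, one_smul] at h
    · obtain ⟨i, t, hne, hlt⟩ := exists_dividedDerivEnd_ne_zero h0
      refine ih _ (hn ▸ hlt) hne ?_ rfl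
      have := (hfz.dividedDeriv_smul i t).sub
        (isVarTorsion_dividedDeriv_mulOp_smul_sub (hz i) f t)
      rwa [sub_sub_cancel] at this

end Torsion

/-! ### Vanishing of graded pieces of Eulerian modules -/

section Graded

variable {k : Type*} [Field k] {d : ℕ} {M : Type*} [AddCommGroup M] [Module (DRing k d) M]
  {ℳ : ℤ → AddSubgroup M}

local notation "mulR" => mulOp k (MvPolynomial (Fin d) k)

theorem eq_zero_of_intCast_smul_eq_zero (k A : Type*) [Field k] [Ring A] [Algebra k A]
    {M : Type*} [AddCommGroup M] [Module A M] {c : ℤ} (hc : (c : k) ≠ 0) {z : M} (h : c • z = 0) :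
    z = 0 := by
  have h1 : algebraMap k A (c : k) • z = 0 := by
    rw [map_intCast, Int.cast_smul_eq_zsmul, h]
  have h2 := congrArg (algebraMap k A (c : k)⁻¹ • ·) h1
  simpa only [smul_zero, ← mul_smul, ← map_mul, inv_mul_cancel₀ hc, map_one, one_smul] using h2

theorem IsGradedDModule.X_smul_mem (hM : IsGradedDModule k d ℳ) (i : Fin d) {ℓ : ℤ} {z : M}
    (hz : z ∈ ℳ ℓ) : mulR (X i) • z ∈ ℳ (ℓ + 1) := by
  rw [add_comm]
  exact hM.smul_mem _ _ _ _ (hasDegree_X k i) hz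

theorem IsGradedDModule.exists_ne_bot [Nontrivial M] (hM : IsGradedDModule k d ℳ) :
    ∃ ℓ, ℳ ℓ ≠ ⊥ := by
  by_contra! h
  obtain ⟨z, hz⟩ := exists_ne (0 : M)
  obtain ⟨u, rfl⟩ := hM.isInternal.2 z
  have hu : u = 0 := by
    refine DFinsupp.ext fun ℓ => Subtype.ext ?_
    exact (AddSubgroup.mem_bot).mp (h ℓ ▸ (u ℓ).2)
  exact hz (by rw [hu, map_zero])

/-- If `ℳ a = ⊥`, an operator of the form `x^s ∂^[s]` with `|s| ≥ ℓ - a` factors through a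
derivative followed by a monomial that lands in degree `a`, so it kills `ℳ ℓ`. -/
theorem IsGradedDModule.eulerOp_smul_eq_zero (hM : IsGradedDModule k d ℳ) {ℓ a : ℤ}
    (ha : ℳ a = ⊥) {z : M} (hz : z ∈ ℳ ℓ) {t : ℕ} (hal : a ≤ ℓ) (ht : ℓ - a ≤ t) :
    eulerOp k d t • z = 0 := by
  rw [eulerOp, Finset.sum_smul]
  refine Finset.sum_eq_zero fun s hs => ?_
  have hs' : (Finsupp.equivFunOnFinite.symm s).degree = t := by
    rw [Finsupp.degree_eq_sum]
    exact (Finset.mem_piAntidiag.mp hs).1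
  have hy : (List.ofFn fun i => dividedDeriv k i (s i)).prod • z ∈ ℳ (-(t : ℤ) + ℓ) := by
    refine hM.smul_mem _ _ _ _ ?_ hz
    have := hasDegree_list_prod_dividedDeriv (k := k) s (List.finRange d)
    rwa [← List.ofFn_eq_map, ← List.ofFn_eq_map, List.sum_ofFn,
      (Finset.mem_piAntidiag.mp hs).1] at this
  -- Split `x^s = x^(s - r) x^r` with `|r| = t - (ℓ - a)`, so that `x^r ∂^[s]` has degree `a - ℓ`.
  obtain ⟨r, hr, hrd⟩ := Finsupp.exists_le_degree_eq (Finsupp.equivFunOnFinite.symm s)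
    (t - (ℓ - a).toNat) (by omega)
  have hprod : (∏ i, X i ^ s i : MvPolynomial (Fin d) k) =
      monomial (Finsupp.equivFunOnFinite.symm s - r) 1 * monomial r 1 := by
    rw [monomial_mul, tsub_add_cancel_of_le hr, mul_one, monic_monomial_eq, Finsupp.prod_fintype]
    · rfl
    · simp
  have h0 : mulR (monomial r 1) • (List.ofFn fun i => dividedDeriv k i (s i)).prod • z ∈ ℳ a := by
    have := hM.smul_mem _ _ _ _ (hasDegree_mulOp (k := k) (isHomogeneous_monomial 1 hrd)) hy
    rwa [show ((t - (ℓ - a).toNat : ℕ) : ℤ) + (-(t : ℤ) + ℓ) = a by omega] at this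
  rw [ha, AddSubgroup.mem_bot] at h0
  rw [mul_smul, hprod, map_mul, mul_smul, h0, smul_zero]

/-- A nonzero piece in degree `ℓ` forces nonzero pieces in all lower degrees, except that
degrees `≥ 0` say nothing about negative degrees. Otherwise the binomial coefficients `(ℓ choose t)`
would vanish in `k` for all large `t`, in particular for `t = ℓ` if `ℓ ≥ 0`. -/
theorem IsEulerianGraded.ne_bot_of_le (hM : IsEulerianGraded k d ℳ) {ℓ a : ℤ} (hℓ : ℳ ℓ ≠ ⊥)
    (hle : a ≤ ℓ) (h : ℓ < 0 ∨ 0 ≤ a) : ℳ a ≠ ⊥ := by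
  intro ha
  obtain ⟨z, hz, hz0⟩ := (AddSubgroup.bot_or_exists_ne_zero _).resolve_left hℓ
  rcases eq_or_lt_of_le hle with rfl | hlt
  · exact hℓ ha
  have hvan : ∀ t : ℕ, ℓ - a ≤ t → ((Ring.choose ℓ t : ℤ) : k) = 0 := by
    intro t ht
    by_contra hc
    refine hz0 (eq_zero_of_intCast_smul_eq_zero k (DRing k d) hc ?_)
    rw [← hM.euler_smul t (by omega) ℓ z hz, hM.eulerOp_smul_eq_zero ha hz hle ht]
  rcases h with h | h
  · obtain ⟨t, ht, hne⟩ := exists_choose_cast_ne_zero_of_neg k h (ℓ - a).toNat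
    exact hne (hvan t (by omega))
  · obtain ⟨n, rfl⟩ := Int.eq_ofNat_of_zero_le (h.trans hle)
    have := hvan n (by omega)
    simp [Ring.choose_natCast] at this

/-- Comparing the eigenvalues of the Euler operators on a vector killed by all variables
determines its degree. -/
theorem IsEulerianGraded.eq_neg_of_X_smul_eq_zero (hM : IsEulerianGraded k d ℳ) {ℓ : ℤ} {z : M}
    (hz : z ∈ ℳ ℓ) (hz0 : z ≠ 0) (h : ∀ i, mulR (X i) • z = 0) : ℓ = -(d : ℤ) := by
  refine eq_of_forall_choose_cast_eq k fun t => ?_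
  rcases Nat.eq_zero_or_pos t with rfl | ht
  · simp
  · by_contra hc
    refine hz0 (eq_zero_of_intCast_smul_eq_zero k (DRing k d)
      (c := Ring.choose ℓ t - Ring.choose (-(d : ℤ)) t) ?_ ?_)
    · rwa [Int.cast_sub, sub_ne_zero]
    · rw [sub_smul, ← hM.euler_smul t ht ℓ z hz, eulerOp_smul_of_X_smul_eq_zero h, sub_self]

/-- Multiplying a nonzero homogeneous torsion vector by variables as long as possible reaches a
vector killed by all variables, which has degree `-d`. -/
theorem IsEulerianGraded.le_neg_of_isVarTorsion (hM : IsEulerianGraded k d ℳ) {z : M}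
    (ht : IsVarTorsion k d z) (hz0 : z ≠ 0) {ℓ : ℤ} (hz : z ∈ ℳ ℓ) :
    ℓ ≤ -(d : ℤ) ∧ ℳ (-(d : ℤ)) ≠ ⊥ := by
  induction ht generalizing ℓ with
  | zero => exact absurd rfl hz0
  | of_smul z _ ih =>
    by_cases h : ∀ i, mulR (X i) • z = 0
    · have hℓ := hM.eq_neg_of_X_smul_eq_zero hz hz0 h
      refine ⟨hℓ.le, fun hbot => hz0 ?_⟩
      rwa [hℓ, hbot, AddSubgroup.mem_bot] at hz
    · push Not at h
      obtain ⟨i, hi⟩ := h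
      obtain ⟨h1, h2⟩ := ih i hi (hM.X_smul_mem i hz)
      exact ⟨by omega, h2⟩

/-- Degrees of homogeneous vectors that are not torsion can be raised arbitrarily. -/
theorem IsGradedDModule.exists_not_isVarTorsion (hM : IsGradedDModule k d ℳ) {ℓ : ℤ} {z : M}
    (hz : z ∈ ℳ ℓ) (ht : ¬ IsVarTorsion k d z) (n : ℕ) :
    ∃ w ∈ ℳ (ℓ + n), ¬ IsVarTorsion k d w := by
  induction n with
  | zero => exact ⟨z, by simpa using hz, ht⟩
  | succ n ih =>
    obtain ⟨w, hw, hwt⟩ := ih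
    obtain ⟨i, hi⟩ : ∃ i, ¬ IsVarTorsion k d (mulR (X i) • w) := by
      by_contra! h
      exact hwt (.of_smul w h)
    exact ⟨_, by simpa [add_assoc] using hM.X_smul_mem i hw, hi⟩

/-- If a graded `𝒟`-module vanishes in degree `-1`, everything in negative degrees is torsion, as
it becomes zero when it is moved up to degree `-1`. -/
theorem IsGradedDModule.isVarTorsion_of_neg (hM : IsGradedDModule k d ℳ) (h : ℳ (-1) = ⊥)
    {ℓ : ℤ} (hℓ : ℓ < 0) {z : M} (hz : z ∈ ℳ ℓ) : IsVarTorsion k d z := by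
  obtain ⟨n, hn⟩ : ∃ n : ℕ, ℓ + n = -1 := ⟨(-1 - ℓ).toNat, by omega⟩
  by_contra ht
  obtain ⟨w, hw, hwt⟩ := hM.exists_not_isVarTorsion hz ht n
  rw [hn, h, AddSubgroup.mem_bot] at hw
  exact hwt (hw ▸ .zero)

/-- If `ℳ (-1) = ⊥`, take a homogeneous vector that is not torsion, of minimal degree `≥ 0`. All
its derivatives are torsion, so it cannot be killed by a nonzero polynomial. -/
theorem IsGradedDModule.neg_one_ne_bot (hM : IsGradedDModule k d ℳ) (hp : IsPolyTorsion k d M)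
    {ℓ : ℤ} {z : M} (hz : z ∈ ℳ ℓ) (ht : ¬ IsVarTorsion k d z) : ℳ (-1) ≠ ⊥ := by
  classical
  intro h
  have hℓ : 0 ≤ ℓ := by
    by_contra hℓ
    exact ht (hM.isVarTorsion_of_neg h (by omega) hz)
  have hex : ∃ n : ℕ, ∃ w ∈ ℳ n, ¬ IsVarTorsion k d w :=
    ⟨ℓ.toNat, z, by rwa [Int.toNat_of_nonneg hℓ], ht⟩
  obtain ⟨w, hw, hwt⟩ := Nat.find_spec hex
  have hmin : ∀ b < ((Nat.find hex : ℕ) : ℤ), ∀ y ∈ ℳ b, IsVarTorsion k d y := by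
    intro b hb y hy
    by_cases hb0 : b < 0
    · exact hM.isVarTorsion_of_neg h hb0 hy
    · lift b to ℕ using by omega
      by_contra hyt
      exact Nat.find_min hex (by exact_mod_cast hb) ⟨y, hy, hyt⟩
  obtain ⟨f, hf, hfw⟩ := hp w
  refine hwt (isVarTorsion_of_dividedDeriv (fun i v => ?_) hf (hfw ▸ .zero))
  exact hmin _ (by push_cast; omega) _ (hM.smul_mem _ _ _ _ (hasDegree_dividedDeriv k i (v + 1)) hw)

theorem IsEulerianGraded.ne_bot_of_isPolyTorsion (hM : IsEulerianGraded k d ℳ)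
    (hp : IsPolyTorsion k d M) {ℓ : ℤ} {z : M} (hz : z ∈ ℳ ℓ) (ht : ¬ IsVarTorsion k d z) (a : ℤ) :
    ℳ a ≠ ⊥ := by
  rcases lt_or_ge a 0 with ha | ha
  · exact hM.ne_bot_of_le (hM.neg_one_ne_bot hp hz ht) (by omega) (.inl (by omega))
  · obtain ⟨w, hw, hwt⟩ := hM.exists_not_isVarTorsion hz ht (a - ℓ).toNat
    refine hM.ne_bot_of_le (ℓ := ℓ + (a - ℓ).toNat) (fun h => hwt ?_) (by omega) (.inr ha)
    rw [h, AddSubgroup.mem_bot] at hw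
    exact hw ▸ .zero

/-! ### The dimension of the support -/

theorem IsGradedDModule.isVarTorsion_of_homogeneous (hM : IsGradedDModule k d ℳ)
    (h : ∀ ℓ, ∀ z ∈ ℳ ℓ, IsVarTorsion k d z) (z : M) : IsVarTorsion k d z := by
  obtain ⟨u, rfl⟩ := hM.isInternal.2 z
  induction u using DirectSum.induction_on with
  | zero => rw [map_zero]; exact .zero
  | of ℓ x => rw [DirectSum.coeAddMonoidHom_of]; exact h ℓ x x.2
  | add x y hx hy => rw [map_add]; exact hx.add hy

/-- The annihilator of a homogeneous vector is a homogeneous ideal. -/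
theorem IsGradedDModule.homogeneousComponent_smul_eq_zero (hM : IsGradedDModule k d ℳ) {ℓ : ℤ}
    {z : M} (hz : z ∈ ℳ ℓ) {f : MvPolynomial (Fin d) k} (hf : mulR f • z = 0) (n : ℕ) :
    mulR (homogeneousComponent n f) • z = 0 := by
  have hmem : ∀ j : ℕ, mulR (homogeneousComponent j f) • z ∈ ℳ (j + ℓ) := fun j =>
    hM.smul_mem _ _ _ _ (hasDegree_mulOp (homogeneousComponent_isHomogeneous j f)) hz
  by_cases hn : f.totalDegree < n
  · rw [homogeneousComponent_eq_zero _ _ hn, map_zero, zero_smul]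
  -- The decomposition of `f • z = 0` into homogeneous components, in the external direct sum.
  set u : DirectSum ℤ fun ℓ => ℳ ℓ := ∑ j ∈ Finset.range (f.totalDegree + 1),
    DirectSum.of (fun ℓ => ℳ ℓ) (j + ℓ) ⟨_, hmem j⟩ with hu
  have hu0 : u = 0 := by
    apply hM.isInternal.1
    rw [map_zero, hu, map_sum]
    simp only [DirectSum.coeAddMonoidHom_of]
    rw [← Finset.sum_smul, ← map_sum, sum_homogeneousComponent, hf]
  have h1 := congrArg (fun v : DirectSum ℤ fun ℓ => ℳ ℓ => ((v (n + ℓ) : ℳ (n + ℓ)) : M)) hu0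
  simp only [hu, DirectSum.sum_apply, AddSubgroup.val_finsetSum, DirectSum.zero_apply,
    ZeroMemClass.coe_zero] at h1
  rw [Finset.sum_eq_single n] at h1
  · rwa [DirectSum.of_eq_same] at h1
  · intro j _ hj
    rw [DirectSum.of_eq_of_ne _ _ _ (by omega)]
    rfl
  · intro hn'
    simp at hn'
    omega

variable (k d M) in
/-- The action of `k[x₁, …, x_d]` on a `𝒟`-module that enters the definition of `suppDim`. -/
noncomputable abbrev polyModule : Module (MvPolynomial (Fin d) k) M :=
  Module.compHom M (mulOp k (MvPolynomial (Fin d) k))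

attribute [local instance] MvPolynomial.gradedAlgebra

/-- If no prime in the support is strictly contained in another one, all homogeneous vectors are
torsion: for a prime `P` containing the annihilator of a homogeneous vector, the largest homogeneous
ideal `P'` in `P` is also a prime containing it, and `P'` lies in `(x₁, …, x_d)`, so
`P = P' = (x₁, …, x_d)`. -/
theorem IsGradedDModule.isVarTorsion_of_suppDim_eq_zero (hM : IsGradedDModule k d ℳ)
    (h : suppDim k d M = 0) {ℓ : ℤ} {z : M} (hz : z ∈ ℳ ℓ) : IsVarTorsion k d z := by
  let _ := polyModule k d M
  set 𝒜 := homogeneousSubmodule (Fin d) k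
  set I : Ideal (MvPolynomial (Fin d) k) :=
    (Submodule.span (MvPolynomial (Fin d) k) {z}).annihilator
  have hI : ∀ f, f ∈ I ↔ mulR f • z = 0 := fun f =>
    Submodule.mem_annihilator_span_singleton z f
  have hIh : I.IsHomogeneous 𝒜 := by
    intro n f hf
    have : ((DirectSum.decompose 𝒜 f n : 𝒜 n) : MvPolynomial (Fin d) k) =
        homogeneousComponent n f := decomposition.decompose'_apply f n
    rw [this, hI]
    exact hM.homogeneousComponent_smul_eq_zero hz ((hI f).mp hf) n
  have hsupp : ∀ p : PrimeSpectrum (MvPolynomial (Fin d) k), I ≤ p.asIdeal →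
      p ∈ Module.support (MvPolynomial (Fin d) k) M := fun p hp =>
    Module.mem_support_iff_exists_annihilator.mpr ⟨z, hp⟩
  have heq : ∀ p q : PrimeSpectrum (MvPolynomial (Fin d) k), I ≤ p.asIdeal → p ≤ q → p = q := by
    intro p q hp hpq
    by_contra hne
    have hpos : 0 < Order.krullDim (Module.support (MvPolynomial (Fin d) k) M) :=
      Order.krullDim_pos_iff.mpr
        ⟨⟨p, hsupp p hp⟩, ⟨q, hsupp q (hp.trans hpq)⟩,
          Subtype.mk_lt_mk.mpr (lt_of_le_of_ne hpq hne)⟩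
    exact hpos.ne' h
  have hrad : idealOfVars (Fin d) k ≤ I.radical := by
    rw [Ideal.radical_eq_sInf]
    refine le_sInf fun P ⟨hIP, hP⟩ => ?_
    set P' : Ideal (MvPolynomial (Fin d) k) := (P.homogeneousCore 𝒜).toIdeal
    have hP' : P'.IsPrime := hP.homogeneousCore
    have hP'P : P' ≤ P := Ideal.toIdeal_homogeneousCore_le 𝒜 P
    have hIP' : I ≤ P' := by
      rw [← hIh.toIdeal_homogeneousCore_eq_self]
      exact Ideal.homogeneousCore_mono 𝒜 hIP
    -- `Q` is the ideal `(x₁, …, x_d)`, written so that its primality is evident.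
    set Q : Ideal (MvPolynomial (Fin d) k) := RingHom.ker (constantCoeff (σ := Fin d) (R := k))
    have hQ : Q.IsPrime := RingHom.ker_isPrime _
    have hP'Q : P' ≤ Q := by
      intro f hf
      have h0 := homogeneousComponent_mem_of_mem (P.homogeneousCore 𝒜).isHomogeneous hf 0
      rw [homogeneousComponent_zero] at h0
      by_contra hfQ
      refine hP'.ne_top (Ideal.eq_top_of_isUnit_mem _ h0 ?_)
      exact (isUnit_iff_ne_zero.mpr hfQ).map C
    have e1 := congrArg PrimeSpectrum.asIdeal (heq ⟨P', hP'⟩ ⟨P, hP⟩ hIP' hP'P)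
    have e2 := congrArg PrimeSpectrum.asIdeal (heq ⟨P', hP'⟩ ⟨Q, hQ⟩ hIP' hP'Q)
    change P' = P at e1
    change P' = Q at e2
    rw [← e1, e2, Ideal.span_le]
    rintro _ ⟨i, rfl⟩
    exact constantCoeff_X k i
  obtain ⟨N, hN⟩ := Ideal.exists_pow_le_of_le_radical_of_fg_radical hrad
    (IsNoetherian.noetherian _)
  exact isVarTorsion_of_pow_smul_eq_zero fun f hf => (hI f).mp (hN hf)

/-- If all vectors are torsion, then `(x₁, …, x_d)` is the only prime in the support. -/
theorem suppDim_le_zero_of_isVarTorsion (h : ∀ z : M, IsVarTorsion k d z) :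
    suppDim k d M ≤ 0 := by
  let _ := polyModule k d M
  by_contra! hpos
  obtain ⟨⟨p, hp⟩, ⟨q, hq⟩, hlt⟩ := Order.krullDim_pos_iff.mp hpos
  obtain ⟨z, hz⟩ := Module.mem_support_iff_exists_annihilator.mp hp
  have hX : ∀ i, X i ∈ p.asIdeal := (h z).X_mem (hP := p.2) fun f hf =>
    hz ((Submodule.mem_annihilator_span_singleton z f).mpr hf)
  have hker : RingHom.ker (constantCoeff (σ := Fin d) (R := k)) ≤ p.asIdeal := by
    intro f hf
    have hf' : f ∈ idealOfVars (Fin d) k ^ 1 := by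
      refine (mem_pow_idealOfVars_iff ..).mpr fun b hb => ?_
      rw [Nat.one_le_iff_ne_zero]
      intro hb0
      rw [(Finsupp.degree_eq_zero_iff b).mp hb0, MvPolynomial.mem_support_iff] at hb
      exact hb hf
    rw [pow_one] at hf'
    refine Ideal.span_le.mpr ?_ hf'
    rintro _ ⟨i, rfl⟩
    exact hX i
  have hmax : (RingHom.ker (constantCoeff (σ := Fin d) (R := k))).IsMaximal :=
    RingHom.ker_isMaximal_of_surjective _ fun c => ⟨C c, constantCoeff_C _ c⟩
  have hlt' : p.asIdeal < q.asIdeal := hlt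
  exact q.2.ne_top (hmax.1.2 _ (hker.trans_lt hlt'))

end Graded

end EulerianDMod

theorem mainTheorem2 {k : Type*} [Field k] (d : ℕ) (hd : 1 ≤ d)
    {M : Type*} [AddCommGroup M] [Nontrivial M] [Module (EulerianDMod.DRing k d) M]
    (ℳ : ℤ → AddSubgroup M) (hM : EulerianDMod.IsEulerianGraded k d ℳ) :
    (EulerianDMod.suppDim k d M = 0 →
      (∀ ℓ : ℤ, -(d : ℤ) < ℓ → ℳ ℓ = ⊥) ∧ (∀ ℓ : ℤ, ℓ ≤ -(d : ℤ) → ℳ ℓ ≠ ⊥)) ∧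
    (0 < EulerianDMod.suppDim k d M → EulerianDMod.IsPolyTorsion k d M →
      ∀ ℓ : ℤ, ℳ ℓ ≠ ⊥) ∧
    (EulerianDMod.IsPolyTorsion k d M → ∀ ℓ : ℤ, ℓ ≤ -(d : ℤ) → ℳ ℓ ≠ ⊥) := by
  have htors : (∀ ℓ, ∀ z ∈ ℳ ℓ, EulerianDMod.IsVarTorsion k d z) →
      ∀ ℓ : ℤ, ℓ ≤ -(d : ℤ) → ℳ ℓ ≠ ⊥ := by
    intro h ℓ hℓ
    obtain ⟨n, hn⟩ := hM.exists_ne_bot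
    obtain ⟨z, hz, hz0⟩ := (AddSubgroup.bot_or_exists_ne_zero _).resolve_left hn
    exact hM.ne_bot_of_le (hM.le_neg_of_isVarTorsion (h n z hz) hz0 hz).2 hℓ (.inl (by omega))
  refine ⟨fun h0 => ⟨fun ℓ hℓ => ?_, htors fun ℓ z hz => ?_⟩, fun hpos hp => ?_, fun hp => ?_⟩
  · by_contra hne
    obtain ⟨z, hz, hz0⟩ := (AddSubgroup.bot_or_exists_ne_zero _).resolve_left hne
    have := (hM.le_neg_of_isVarTorsion (hM.isVarTorsion_of_suppDim_eq_zero h0 hz) hz0 hz).1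
    omega
  · exact hM.isVarTorsion_of_suppDim_eq_zero h0 hz
  · obtain ⟨n, z, hz, ht⟩ : ∃ n, ∃ z ∈ ℳ n, ¬ EulerianDMod.IsVarTorsion k d z := by
      by_contra! h
      exact (EulerianDMod.suppDim_le_zero_of_isVarTorsion
        (hM.isVarTorsion_of_homogeneous h)).not_gt hpos
    exact hM.ne_bot_of_isPolyTorsion hp hz ht
  · by_cases h : ∀ ℓ, ∀ z ∈ ℳ ℓ, EulerianDMod.IsVarTorsion k d z
    · exact htors h
    · push Not at h
      obtain ⟨n, z, hz, ht⟩ := h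
      exact fun ℓ _ => hM.ne_bot_of_isPolyTorsion hp hz ht ℓ
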